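/- **Theorem (probabilistic completeness of the Lazy Tree-based Replanner LTR\*).** *Setting.* Let $d\ge 1$. A manipulator with configurations in $\mathbb R^d$ executes a finite list of object manipulation tasks $\tau_1,\dots,\tau_n$ in order; $\tau_i$ consists of an object $\Theta_i$ and a target pose in $\mathrm{SE}(3)$, and a map $f_q$ assigns a grasp configuration to each object and pose. Each task gives two planning requests $(C_{\text{free}},q_{\text{initial}},q_{\text{target}})$: first from the current configuration to the grasp configuration of $\Theta_i$ at its current pose, then, with $\Theta_i$ attached, from there to the grasp configuration at its target pose. Between requests the measurable free space $C_{\text{free}}\subseteq\mathbb R^d$ changes with the poses of the objects and with the attached object. All samples are independent and, within a request, uniform on a measurable set $S\supseteq C_{\text{free}}$ of finite volume (for example $S=C_{\text{free}}$, or $S$ the whole configuration space). *Algorithm.* LTR\* keeps a finite graph $\mathcal G$ on configurations (the lazy experience graph), initially empty. A straight segment is *valid* if it lies in the current $C_{\text{free}}$. For each request it starts a tree rooted at $q_{\text{initial}}$, a tree rooted at $q_{\text{target}}$, and a temporary graph $\mathcal G'$ with these two vertices and no edges. In each round, for each of the two trees $\mathcal T$ in turn, with $n$ the current number of vertices of $\mathcal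 T$ and $\epsilon_n=\gamma(\log n/n)^{1/d}$: 1. A sample $q$ is drawn, and $v_{\text{new}}$ is the point reached from the vertex of $\mathcal T$ nearest to $q$ by moving towards $q$ by at most $\eta$. If this motion is not valid, nothing more is done for this tree in this round. Otherwise $v_{\text{new}}$ is inserted into $\mathcal T$ by the RRT\* insertion: its parent is the vertex of least cost-to-come among the nearest one and those within $\epsilon_n$ with a valid segment to it, and the vertices within $\epsilon_n$ are then rewired through it where this is valid and strictly cheaper. The other tree is extended in the same way towards $v_{\text{new}}$, repeatedly, until it reaches $v_{\text{new}}$ or is blocked. 2. The vertex $v_{\text{new}}$, its parent edge, and (unchecked) edges from $v_{\text{new}}$ to all vertices of $\mathcal G'$ within $\epsilon_n$ are added to $\mathcal G'$. 3. If the two trees share a vertex, the path through both trees becomes the solution path. 4. All $v\in\mathcal G$ within $\epsilon_n$ of $v_{\text{new}}$ with a valid segment to it are inserted into $\mathcal T$, with rewiring. 5. If there is no solution path yet and both trees have a vertex in $\mathcal G$, the solution path becomes a cheapest path that runs in the first tree from $q_{\text{initial}}$ to a vertex of $\mathcal G$, then along valid edges of $\mathcal G$, then in the second tree to $q_{\text{target}}$,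 if such a path exists. After the rounds granted to a request, $\mathcal G'$ is merged into $\mathcal G$. Here $\eta>0$ is a fixed step, straight motions have arbitrary non-negative costs, ties are broken arbitrarily, and $\gamma>2(1+1/d)^{1/d}(\mu(C_{\text{free}})/\xi_d)^{1/d}$ for each request, where $\mu$ is Lebesgue measure and $\xi_d$ is the volume of the unit ball. *Claim.* Suppose that each request has a solution: a continuous path $\sigma:[0,1]\to C_{\text{free}}$ from $q_{\text{initial}}$ to $q_{\text{target}}$, all of whose points are interior to $C_{\text{free}}$ (if $C_{\text{free}}$ is open, any continuous path in $C_{\text{free}}$). Then for each task $\tau_i$ and each of its two requests, if $V_t$ denotes the set of configurations that after $t$ rounds are reachable from $q_{\text{initial}}$ through edges of the two trees and of the solution path, $$\lim_{t\to\infty}\mathbb P\bigl(V_t\cap\{q_{\text{target}}\}\neq\emptyset\bigr)=1 .$$ This holds whatever numbers of rounds were granted to the earlier requests; these numbers may even depend on $t$ (for instance, all equal to $t$). If the event is not measurable, the claim means that the outer probabilities of the event and of its complement tend to $1$ and $0$. -/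

import Mathlib

open MeasureTheory ProbabilityTheory Filter Topology
open scoped NNReal ENNReal Classical

namespace LTR

/-- Configurations: points of `ℝ^d` with the Euclidean norm. -/
abbrev Conf (d : ℕ) : Type := EuclideanSpace ℝ (Fin d)

/-! ### Tasks and planning queries -/

/-- Poses in `SE(3)`: a position together with a rotation. -/
abbrev Pose : Type :=
  EuclideanSpace ℝ (Fin 3) × Matrix.specialOrthogonalGroup (Fin 3) ℝ

/-- Arrangement of the movable objects: their poses, and the object (if any) that is currently
attached to the manipulator. -/
structure World (Obj : Type*) where
  pose : Obj → Pose
  held : Option Obj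

/-- An object manipulation task: an object and its target pose. -/
structure Task (Obj : Type*) where
  object : Obj
  target : Pose

/-- One planning request: the current free space, the region the planner samples from,
and the two configurations to be joined. -/
structure Query (d : ℕ) where
  free : Set (Conf d)
  region : Set (Conf d)
  init : Conf d
  target : Conf d

/-- The planning requests caused by a list of tasks, executed in the given order from the world `w`
and the manipulator configuration `q`. Each task causes two requests: reach the object, then (with
the object attached) carry it to its target. Free space and sampling region depend on the current
world; `fq` is the grasp map. -/
noncomputable def queries {d : ℕ} {Obj : Type*} (free region : World Obj → Set (Conf d))
    (fq : Obj → Pose → Conf d) : World Obj → Conf d → List (Task Obj) → List (Query d)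
  | _, _, [] => []
  | w, q, τ :: ts =>
    let carrying : World Obj := { pose := w.pose, held := some τ.object }
    let after : World Obj := { pose := Function.update w.pose τ.object τ.target, held := none }
    { free := free w, region := region w,
      init := q, target := fq τ.object (w.pose τ.object) } ::
    { free := free carrying, region := region carrying,
      init := fq τ.object (w.pose τ.object), target := fq τ.object τ.target } ::
    queries free region fq after (fq τ.object τ.target) ts

/-- A solution exists: a continuous path from the initial to the target configuration all of whose
configurations are surrounded by free space. For an open free space this is any continuous path
in the free space. -/
def Query.Solvable {d : ℕ} (Q : Query d) : Prop :=
  ∃ σ : ℝ → Conf d, ContinuousOn σ (Set.Icc 0 1) ∧ σ 0 = Q.init ∧ σ 1 = Q.target ∧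
    ∀ θ ∈ Set.Icc (0 : ℝ) 1, σ θ ∈ interior Q.free

/-! ### Parameters and trees -/

/-- Parameters of the planner: steering step `η`, the factor `γ` of the connection radius, and the
cost of a straight-line motion. -/
structure Params (d : ℕ) where
  η : ℝ
  γ : ℝ
  c : Conf d → Conf d → ℝ≥0

/-- The connection radius `ε_n = γ (log n / n)^(1/d)`. -/
noncomputable def Params.eps {d : ℕ} (P : Params d) (n : ℕ) : ℝ :=
  P.γ * (Real.log n / n) ^ (1 / (d : ℝ))

/-- The critical value `γ* = 2 (1 + 1/d)^(1/d) (μ(S) / ξ_d)^(1/d)`, where `ξ_d` is the volume of the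
unit ball. -/
noncomputable def gammaStar {d : ℕ} (S : Set (Conf d)) : ℝ :=
  2 * (1 + 1 / (d : ℝ)) ^ (1 / (d : ℝ)) *
    ((volume S).toReal / (volume (Metric.ball (0 : Conf d) 1)).toReal) ^ (1 / (d : ℝ))

/-- A minimiser of `f` on a finite set, ties being broken in an unspecified way. -/
noncomputable def argMin {d : ℕ} {α : Type*} [LinearOrder α] (s : Finset (Conf d))
    (f : Conf d → α) : Conf d :=
  if h : s.Nonempty then (s.exists_min_image f h).choose else 0

/-- A search tree, stored through parent pointers (the root points to itself). -/
structure Tree (d : ℕ) where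
  root : Conf d
  verts : Finset (Conf d)
  parent : Conf d → Conf d

/-- The tree with a single vertex. -/
def Tree.single {d : ℕ} (q : Conf d) : Tree d where
  root := q
  verts := {q}
  parent := id

/-- Number of edges between a vertex and the root. -/
noncomputable def Tree.depth {d : ℕ} (T : Tree d) (v : Conf d) : ℕ :=
  sInf {k : ℕ | T.parent^[k] v = T.root}

/-- Cost of the tree path from the root to `v`. -/
noncomputable def Tree.cost {d : ℕ} (P : Params d) (T : Tree d) (v : Conf d) : ℝ≥0 :=
  ∑ i ∈ Finset.range (T.depth v), P.c (T.parent^[i + 1] v) (T.parent^[i] v)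

/-- The tree path from `v` up to the root. -/
noncomputable def Tree.branch {d : ℕ} (T : Tree d) (v : Conf d) : List (Conf d) :=
  List.iterate T.parent v (T.depth v + 1)

/-- The straight-line motion between `x` and `y` is collision free. -/
def FreeSeg {d : ℕ} (free : Set (Conf d)) (x y : Conf d) : Prop :=
  segment ℝ x y ⊆ free

/-- Move from `x` towards `q` by at most `η`. -/
noncomputable def steer {d : ℕ} (η : ℝ) (x q : Conf d) : Conf d :=
  if dist x q ≤ η then q else x + (η / dist x q) • (q - x)

/-- Make `x` the parent of `y` if this is collision free and strictly cheaper. -/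
noncomputable def Tree.rewireAt {d : ℕ} (P : Params d) (free : Set (Conf d)) (x : Conf d)
    (T : Tree d) (y : Conf d) : Tree d :=
  if FreeSeg free x y ∧ T.cost P x + P.c x y < T.cost P y then
    { T with parent := Function.update T.parent y x }
  else T

/-- Rewire, one after the other, all vertices within radius `r` of `x` through `x`. -/
noncomputable def Tree.rewire {d : ℕ} (P : Params d) (free : Set (Conf d)) (r : ℝ) (x : Conf d)
    (T : Tree d) : Tree d :=
  (T.verts.filter fun y => dist y x ≤ r).toList.foldl (Tree.rewireAt P free x) T

/-- The insertion step of RRT*: `x` is attached to the cheapest parent among `x₀` and the vertices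
within radius `r` from which `x` is reached without collision, and the vertices within radius `r`
of `x` are rewired. A vertex already present is not inserted again. (Called only for a vertex `x₀`
whose segment to `x` is collision free.) -/
noncomputable def Tree.insert {d : ℕ} (P : Params d) (free : Set (Conf d)) (r : ℝ)
    (T : Tree d) (x₀ x : Conf d) : Tree d :=
  if x ∈ T.verts then T
  else
    let p := argMin (T.verts.filter fun y => (y = x₀ ∨ dist y x ≤ r) ∧ FreeSeg free y x)
      (fun y => T.cost P y + P.c y x)
    Tree.rewire P free r x
      { root := T.root, verts := Insert.insert x T.verts, parent := Function.update T.parent x p }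

/-- The extension step: steer from the nearest vertex towards `q`, and insert the configuration
that is reached if the motion is collision free. Returns the new vertex, or `none` if blocked. -/
noncomputable def Tree.extend {d : ℕ} (P : Params d) (free : Set (Conf d)) (r : ℝ)
    (T : Tree d) (q : Conf d) : Tree d × Option (Conf d) :=
  let x := argMin T.verts (fun v => dist v q)
  let y := steer P.η x q
  if FreeSeg free x y then (T.insert P free r x y, some y) else (T, none)

/-- The greedy connection step: extend the tree towards `x` until `x` is reached or the motion is
blocked. Each successful extension brings the tree closer to `x` by `η`, and an extension after `x`
is reached or after a blocked one changes nothing, so the number of rounds below suffices. -/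
noncomputable def Tree.connect {d : ℕ} (P : Params d) (free : Set (Conf d)) (r : ℝ)
    (T : Tree d) (x : Conf d) : Tree d :=
  (fun T' : Tree d => (T'.extend P free r x).1)^[
    ⌈dist (argMin T.verts (fun v => dist v x)) x / P.η⌉₊] T

/-! ### The lazy experience graph -/

/-- A finite graph on configurations. Its edges are stored without any promise that they are
collision free: free space changes between the planning requests. -/
structure Graph (d : ℕ) where
  verts : Finset (Conf d)
  edges : Finset (Sym2 (Conf d))

/-- Union of two graphs. -/
noncomputable def Graph.merge {d : ℕ} (G H : Graph d) : Graph d where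
  verts := G.verts ∪ H.verts
  edges := G.edges ∪ H.edges

/-- Add the edge between `v` and `p`, and join `v` to all vertices within radius `r`, without
collision checks. -/
noncomputable def Graph.record {d : ℕ} (G : Graph d) (r : ℝ) (v p : Conf d) : Graph d where
  verts := Insert.insert v (Insert.insert p G.verts)
  edges := Insert.insert s(v, p)
    (G.edges ∪ (G.verts.filter fun v' => v' ≠ v ∧ dist v' v ≤ r).image fun v' => s(v, v'))

/-- Cost of a polygonal path. -/
noncomputable def pathCost {d : ℕ} (P : Params d) : List (Conf d) → ℝ≥0
  | [] => 0
  | [_] => 0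
  | x :: y :: l => P.c x y + pathCost P (y :: l)

/-- `l` runs inside the tree `A` from its root to a vertex of `G`, then along edges of `G` that turn
out collision free in the current free space, and then inside the tree `B` to its root. -/
def ViaGraph {d : ℕ} (free : Set (Conf d)) (G : Graph d) (A B : Tree d) (l : List (Conf d)) :
    Prop :=
  ∃ (u w : Conf d) (p : List (Conf d)), u ∈ A.verts ∧ u ∈ G.verts ∧ w ∈ B.verts ∧ w ∈ G.verts ∧
    p.head? = some u ∧ p.getLast? = some w ∧
    p.IsChain (fun x y => s(x, y) ∈ G.edges ∧ FreeSeg free x y) ∧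
    l = (A.branch u).reverse ++ p.tail ++ (B.branch w).tail

/-- The result of the lazy shortest path search through `G`: a cheapest path as above if there is
one, and the empty list otherwise. -/
noncomputable def lazySearch {d : ℕ} (P : Params d) (free : Set (Conf d)) (G : Graph d)
    (A B : Tree d) : List (Conf d) :=
  if h : ∃ l, ViaGraph free G A B l ∧ ∀ l', ViaGraph free G A B l' → pathCost P l ≤ pathCost P l'
  then h.choose else []

/-! ### The planner -/

/-- State of the planning subroutine: the two trees (`false`: rooted at the initial configuration,
`true`: rooted at the target), the temporary graph, and the solution path (`[]`: none yet). -/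
structure PlanState (d : ℕ) where
  tree : Bool → Tree d
  graph : Graph d
  sol : List (Conf d)

noncomputable def PlanState.start {d : ℕ} (Q : Query d) : PlanState d where
  tree := fun b => Tree.single (if b then Q.target else Q.init)
  graph := { verts := {Q.init, Q.target}, edges := ∅ }
  sol := []

/-- If the two trees share a vertex, store a cheapest path through a common vertex. -/
noncomputable def PlanState.joinTrees {d : ℕ} (P : Params d) (s : PlanState d) : PlanState d :=
  let common := (s.tree false).verts ∩ (s.tree true).verts
  let path := fun x => ((s.tree false).branch x).reverse ++ ((s.tree true).branch x).tail
  if common.Nonempty then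
    { s with sol := path (argMin common fun x => pathCost P (path x)) }
  else s

/-- If there is no solution yet, and both trees have a vertex in `G`, search through `G`. -/
noncomputable def PlanState.useGraph {d : ℕ} (P : Params d) (free : Set (Conf d)) (G : Graph d)
    (s : PlanState d) : PlanState d :=
  if s.sol = [] ∧ ∀ b, ((s.tree b).verts ∩ G.verts).Nonempty then
    { s with sol := lazySearch P free G (s.tree false) (s.tree true) }
  else s

/-- Attach to the tree `T` all vertices of `G` within radius `r` of its vertex `v` to which `v` can
be connected. -/
noncomputable def Tree.absorb {d : ℕ} (P : Params d) (free : Set (Conf d)) (r : ℝ) (G : Graph d)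
    (v : Conf d) (T : Tree d) : Tree d :=
  (G.verts.filter fun u => dist u v ≤ r).toList.foldl
    (fun T' u => if FreeSeg free v u then T'.insert P free r v u else T') T

/-- One pass of the inner loop, for the tree `b` and the random sample `q`, with experience graph
`G`. The radius is `ε_n`, where `n` is the number of nodes of the tree being grown. -/
noncomputable def PlanState.grow {d : ℕ} (P : Params d) (free : Set (Conf d)) (G : Graph d)
    (b : Bool) (q : Conf d) (s : PlanState d) : PlanState d :=
  let r := P.eps (s.tree b).verts.card
  match (s.tree b).extend P free r q with
  | (_, none) => s
  | (T, some v) =>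
    let T' := (s.tree (!b)).connect P free r v
    let s₁ : PlanState d :=
      { tree := Function.update (Function.update s.tree b T) (!b) T'
        graph := s.graph.record r v (T.parent v)
        sol := s.sol }
    let s₂ := s₁.joinTrees P
    let s₃ : PlanState d :=
      { s₂ with tree := Function.update s₂.tree b ((s₂.tree b).absorb P free r G v) }
    s₃.useGraph P free G

/-- The planning subroutine for the request `Q` with experience graph `G`, after `t` rounds of its
main loop; `z t b` is the sample drawn in round `t` for the tree `b`. -/
noncomputable def plan {d : ℕ} (P : Params d) (Q : Query d) (G : Graph d)
    (z : ℕ → Bool → Conf d) : ℕ → PlanState d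
  | 0 => PlanState.start Q
  | t + 1 => ((plan P Q G z t).grow P Q.free G false (z t false)).grow P Q.free G true (z t true)

/-- The experience graph with which request number `k` is started. It is empty at first, and the
temporary graph of each request `j < k`, which runs for `budget j` rounds, is merged into it;
`z j t b` is the sample drawn during request `j` in round `t` for the tree `b`. -/
noncomputable def experience {d : ℕ} (P : Params d) (Qs : List (Query d)) (budget : ℕ → ℕ)
    (z : ℕ → ℕ → Bool → Conf d) : ℕ → Graph d
  | 0 => { verts := ∅, edges := ∅ }
  | k + 1 =>
    let G := experience P Qs budget z k
    match Qs[k]? with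
    | none => G
    | some Q => G.merge (plan P Q G (z k) (budget k)).graph

/-- `u` and `v` are joined by an edge that was verified: an edge of one of the two trees, or an edge
of the solution path. -/
def PlanState.Joined {d : ℕ} (s : PlanState d) (u v : Conf d) : Prop :=
  (∃ b, u ∈ (s.tree b).verts ∧ (s.tree b).parent u = v) ∨ [u, v] <:+: s.sol

/-- The configurations reachable from the initial configuration through connected edges. -/
def PlanState.reachable {d : ℕ} (s : PlanState d) : Set (Conf d) :=
  {x | Relation.ReflTransGen (fun u v => s.Joined u v ∨ s.Joined v u) (s.tree false).root x}

/-- The set of configurations reachable from the initial configuration after `t` rounds of request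
number `k`, when the earlier requests `j < k` ran for `budget j` rounds. -/
noncomputable def reachableSet {d : ℕ} (P : Params d) (Qs : List (Query d)) (budget : ℕ → ℕ)
    (z : ℕ → ℕ → Bool → Conf d) (k : ℕ) (hk : k < Qs.length) (t : ℕ) : Set (Conf d) :=
  (plan P Qs[k] (experience P Qs budget z k) (z k) t).reachable

end LTR

/-!
The experience graph, the rewiring and the connection radius can only add vertices and change
parents, so the completeness argument for a plain RRT survives. Along a solution path choose points
`x 0, …, x N` at distances less than `δ`, with free balls of radius `4 δ` around them, where
`3 δ ≤ η` (`Query.Solvable.exists_chain`). If the tree of the initial configuration has a vertex in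
the `δ`-ball around `x i` and the sample falls into the `δ`-ball around `x (i + 1)`, then the nearest
vertex is within `3 δ` of the sample, so the sample itself is inserted. When this happens in the
ball around the target, the other tree connects to the sample in a single step, and the trees share
a vertex (`target_mem_reachable_of_samples`). The initial and the target configuration are then
joined by tree edges, because parent pointers always lead to the root: rewiring makes a vertex
strictly cheaper, while an ancestor of `x` is never more expensive than `x`
(`Tree.Rooted.cost_ancestor_le`), so that no cycle can arise.

This sufficient condition mentions only the samples of the current request, hence neither the
earlier requests nor their budgets matter. Divide `t` rounds into `N` blocks of `t / N` rounds. By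
independence, block `i` misses its ball with probability `q_i ^ (t / N)` with `q_i < 1`, and the sum
of these over `i < N` tends to `0`.
-/

namespace LTR

variable {d : ℕ}

/-! ### Rooted trees -/

/-- The parent pointers form a tree on the vertex set: they stay inside it and lead from every
vertex to the root. This is what rules out cycles. -/
structure Tree.Rooted (T : Tree d) : Prop where
  root_mem : T.root ∈ T.verts
  parent_root : T.parent T.root = T.root
  parent_mem : ∀ v ∈ T.verts, T.parent v ∈ T.verts
  reach : ∀ v ∈ T.verts, ∃ k, T.parent^[k] v = T.root

/-- `T'` is a rooted tree with the root of `T` that has kept all vertices of `T`; the parents may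
have changed. -/
structure Tree.Extends (T T' : Tree d) : Prop where
  root_eq : T'.root = T.root
  subset : T.verts ⊆ T'.verts
  rooted : T'.Rooted

theorem Tree.Rooted.refl {T : Tree d} (h : T.Rooted) : T.Extends T :=
  ⟨rfl, subset_rfl, h⟩

theorem Tree.Extends.trans {T T' T'' : Tree d} (h : T.Extends T') (h' : T'.Extends T'') :
    T.Extends T'' :=
  ⟨h'.root_eq.trans h.root_eq, h.subset.trans h'.subset, h'.rooted⟩

theorem Tree.single_rooted (q : Conf d) : (Tree.single q).Rooted := by
  refine ⟨by simp [Tree.single], rfl, ?_, ?_⟩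
  · intro v hv
    exact hv
  · intro v hv
    exact ⟨0, by simpa [Tree.single] using hv⟩

theorem Tree.Rooted.iterate_root {T : Tree d} (h : T.Rooted) (k : ℕ) :
    T.parent^[k] T.root = T.root :=
  Function.iterate_fixed h.parent_root k

theorem Tree.Rooted.iterate_depth {T : Tree d} (h : T.Rooted) {v : Conf d} (hv : v ∈ T.verts) :
    T.parent^[T.depth v] v = T.root :=
  Nat.sInf_mem (s := {k : ℕ | T.parent^[k] v = T.root}) (h.reach v hv)

theorem Tree.cost_root (P : Params d) (T : Tree d) : T.cost P T.root = 0 := by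
  have : T.depth T.root = 0 := by
    simp [Tree.depth]
  simp [Tree.cost, this]

/-- Costs do not decrease from an ancestor to a descendant, as motions have non-negative costs. -/
theorem Tree.Rooted.cost_ancestor_le {T : Tree d} (h : T.Rooted) (P : Params d) {x : Conf d}
    (hx : x ∈ T.verts) (j : ℕ) : T.cost P (T.parent^[j] x) ≤ T.cost P x := by
  rcases le_total (T.depth x) j with hj | hj
  -- Beyond its depth, the iteration stays at the root, which has cost `0`.
  · have : T.parent^[j] x = T.root := by
      obtain ⟨m, rfl⟩ := Nat.exists_eq_add_of_le' hj
      rw [Function.iterate_add_apply, h.iterate_depth hx, h.iterate_root]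
    rw [this, Tree.cost_root]
    exact zero_le
  · obtain ⟨m, hm⟩ := Nat.exists_eq_add_of_le' hj
    have hdepth : T.depth (T.parent^[j] x) ≤ m := by
      apply Nat.sInf_le
      change T.parent^[m] (T.parent^[j] x) = T.root
      rw [← Function.iterate_add_apply, ← hm, h.iterate_depth hx]
    calc T.cost P (T.parent^[j] x)
        = ∑ i ∈ Finset.range (T.depth (T.parent^[j] x)),
            P.c (T.parent^[i + j + 1] x) (T.parent^[i + j] x) := by
          refine Finset.sum_congr rfl fun i _ => ?_
          rw [← Function.iterate_add_apply, ← Function.iterate_add_apply, Nat.add_right_comm]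
      _ ≤ ∑ i ∈ Finset.range m, P.c (T.parent^[i + j + 1] x) (T.parent^[i + j] x) :=
          Finset.sum_le_sum_of_subset (Finset.range_mono hdepth)
      _ ≤ ∑ i ∈ Finset.range j, P.c (T.parent^[i + 1] x) (T.parent^[i] x) +
            ∑ i ∈ Finset.range m, P.c (T.parent^[i + j + 1] x) (T.parent^[i + j] x) :=
          le_add_self
      _ = T.cost P x := by
          rw [Tree.cost, hm, Nat.add_comm m j, Finset.sum_range_add]
          simp only [Nat.add_comm]

/-- Changing the parent of `y` to `x` creates no cycle if `y` is not an ancestor of `x`. -/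
theorem Tree.Rooted.update_parent {T : Tree d} (h : T.Rooted) {x y : Conf d} (hx : x ∈ T.verts)
    (hy : ∀ j, T.parent^[j] x ≠ y) :
    Tree.Rooted { T with parent := Function.update T.parent y x } := by
  have hroot : T.root ≠ y := by
    obtain ⟨k, hk⟩ := h.reach x hx
    exact hk ▸ hy k
  -- The path from `x` to the root avoids `y`, hence is the same as before.
  have hx' : ∃ k, (Function.update T.parent y x)^[k] x = T.root := by
    have heq : ∀ k, (Function.update T.parent y x)^[k] x = T.parent^[k] x := by
      intro k
      induction k with
      | zero => rfl
      | succ k ih =>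
        rw [Function.iterate_succ_apply', Function.iterate_succ_apply', ih,
          Function.update_of_ne (hy k)]
    obtain ⟨k, hk⟩ := h.reach x hx
    exact ⟨k, (heq k).trans hk⟩
  refine ⟨h.root_mem, ?_, ?_, ?_⟩
  · change Function.update T.parent y x T.root = T.root
    rw [Function.update_of_ne hroot, h.parent_root]
  · intro v hv
    change Function.update T.parent y x v ∈ T.verts
    by_cases hvy : v = y
    · simpa [hvy] using hx
    · simpa [hvy] using h.parent_mem v hv
  · intro v hv
    obtain ⟨k, hk⟩ := h.reach v hv
    change ∃ k, (Function.update T.parent y x)^[k] v = T.root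
    induction k generalizing v with
    | zero => exact ⟨0, hk⟩
    | succ k ih =>
      obtain ⟨m, hm⟩ : ∃ m, (Function.update T.parent y x)^[m] (Function.update T.parent y x v)
          = T.root := by
        by_cases hvy : v = y
        · simpa [hvy] using hx'
        · simpa [hvy] using ih (T.parent v) (h.parent_mem v hv) hk
      exact ⟨m + 1, hm⟩

/-- Adding a new leaf `x` below the vertex `p`. -/
theorem Tree.Rooted.add_leaf {T : Tree d} (h : T.Rooted) {x p : Conf d} (hx : x ∉ T.verts)
    (hp : p ∈ T.verts) :
    Tree.Rooted { root := T.root, verts := Insert.insert x T.verts,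
                  parent := Function.update T.parent x p } := by
  have hne : ∀ v ∈ T.verts, v ≠ x := fun v hv hvx => hx (hvx ▸ hv)
  have hreach : ∀ v ∈ T.verts, ∃ k, (Function.update T.parent x p)^[k] v = T.root := by
    intro v hv
    obtain ⟨k, hk⟩ := h.reach v hv
    induction k generalizing v with
    | zero => exact ⟨0, hk⟩
    | succ k ih =>
      obtain ⟨m, hm⟩ := ih (T.parent v) (h.parent_mem v hv) hk
      refine ⟨m + 1, ?_⟩
      rw [Function.iterate_succ_apply, Function.update_of_ne (hne v hv), hm]
  refine ⟨Finset.mem_insert_of_mem h.root_mem, ?_, ?_, ?_⟩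
  · change Function.update T.parent x p T.root = T.root
    rw [Function.update_of_ne (hne _ h.root_mem), h.parent_root]
  · intro v hv
    change Function.update T.parent x p v ∈ Insert.insert x T.verts
    rcases Finset.mem_insert.1 hv with rfl | hv
    · simp [hp]
    · rw [Function.update_of_ne (hne v hv)]
      exact Finset.mem_insert_of_mem (h.parent_mem v hv)
  · intro v hv
    rcases Finset.mem_insert.1 hv with rfl | hv
    · obtain ⟨m, hm⟩ := hreach p hp
      refine ⟨m + 1, ?_⟩
      change (Function.update T.parent v p)^[m + 1] v = T.root
      rw [Function.iterate_succ_apply, Function.update_self, hm]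
    · exact hreach v hv

/-! ### The tree operations -/

section Operations

variable (P : Params d) (free : Set (Conf d)) (r : ℝ)

theorem argMin_mem {α : Type*} [LinearOrder α] {s : Finset (Conf d)} (f : Conf d → α)
    (hs : s.Nonempty) : argMin s f ∈ s := by
  rw [argMin, dif_pos hs]
  exact (s.exists_min_image f hs).choose_spec.1

theorem argMin_le {α : Type*} [LinearOrder α] {s : Finset (Conf d)} (f : Conf d → α)
    {v : Conf d} (hv : v ∈ s) : f (argMin s f) ≤ f v := by
  have hs : s.Nonempty := ⟨v, hv⟩
  rw [argMin, dif_pos hs]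
  exact (s.exists_min_image f hs).choose_spec.2 v hv

/-- Rewiring is strictly cheaper, so that it never hangs an ancestor of `x` below `x`. -/
theorem Tree.Rooted.rewireAt {T : Tree d} (h : T.Rooted) {x : Conf d} (hx : x ∈ T.verts)
    (y : Conf d) : T.Extends (T.rewireAt P free x y) := by
  unfold Tree.rewireAt
  split_ifs with hc
  · refine ⟨rfl, subset_rfl, h.update_parent hx fun j hj => ?_⟩
    have := h.cost_ancestor_le P hx j
    rw [hj] at this
    exact absurd (hc.2.trans_le this) (not_lt.2 le_self_add)
  · exact h.refl

theorem Tree.Rooted.rewire {T : Tree d} (h : T.Rooted) {x : Conf d} (hx : x ∈ T.verts) :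
    T.Extends (T.rewire P free r x) := by
  unfold Tree.rewire
  generalize (T.verts.filter fun y => dist y x ≤ r).toList = l
  induction l generalizing T with
  | nil => exact h.refl
  | cons y l ih =>
    have h1 := h.rewireAt P free hx y
    exact h1.trans (ih h1.rooted (h1.subset hx))

theorem Tree.Rooted.insert {T : Tree d} (h : T.Rooted) {x₀ x : Conf d} (hx₀ : x₀ ∈ T.verts)
    (hseg : FreeSeg free x₀ x) :
    T.Extends (T.insert P free r x₀ x) ∧ x ∈ (T.insert P free r x₀ x).verts := by
  unfold Tree.insert
  split_ifs with hx
  · exact ⟨h.refl, hx⟩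
  · extract_lets p
    have hp : p ∈ T.verts := by
      refine (Finset.mem_filter.1 (argMin_mem _ ⟨x₀, ?_⟩)).1
      exact Finset.mem_filter.2 ⟨hx₀, Or.inl rfl, hseg⟩
    have hleaf := h.add_leaf hx hp
    have hmem : x ∈ Insert.insert x T.verts := Finset.mem_insert_self _ _
    have hrew := hleaf.rewire P free r hmem
    exact ⟨⟨hrew.root_eq, (Finset.subset_insert _ _).trans hrew.subset, hrew.rooted⟩,
      hrew.subset hmem⟩

theorem Tree.Rooted.nearest_mem {T : Tree d} (h : T.Rooted) (q : Conf d) :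
    argMin T.verts (fun v => dist v q) ∈ T.verts :=
  argMin_mem _ ⟨_, h.root_mem⟩

theorem Tree.Rooted.extend {T : Tree d} (h : T.Rooted) (q : Conf d) :
    T.Extends (T.extend P free r q).1 ∧
      ∀ v, (T.extend P free r q).2 = some v → v ∈ (T.extend P free r q).1.verts := by
  unfold Tree.extend
  extract_lets x y
  split_ifs with hseg
  · obtain ⟨h1, h2⟩ := h.insert P free r (h.nearest_mem q) hseg
    refine ⟨h1, fun v hv => ?_⟩
    obtain rfl : y = v := by simpa using hv
    exact h2
  · exact ⟨h.refl, fun v hv => by simp at hv⟩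

/-- A target `q` that is within one step of the tree, in a convex free neighbourhood, is reached by
a single extension. -/
theorem Tree.extend_snd_eq_some {T : Tree d} {v q c : Conf d} {ρ : ℝ} (hv : v ∈ T.verts)
    (hη : dist v q ≤ P.η) (hq : dist v q + dist q c < ρ) (hfree : Metric.ball c ρ ⊆ free) :
    (T.extend P free r q).2 = some q := by
  have hle : dist (argMin T.verts fun v => dist v q) q ≤ dist v q :=
    argMin_le (fun v => dist v q) hv
  have hsteer : steer P.η (argMin T.verts fun v => dist v q) q = q := if_pos (hle.trans hη)
  have hseg : FreeSeg free (argMin T.verts fun v => dist v q) q := by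
    refine ((convex_ball c ρ).segment_subset ?_ ?_).trans hfree
    · exact (dist_triangle _ q c).trans_lt (by linarith)
    · exact Metric.mem_ball.2 (by linarith [dist_nonneg (x := v) (y := q)])
  simp [Tree.extend, hsteer, hseg]

theorem Tree.Rooted.connect {T : Tree d} (h : T.Rooted) (x : Conf d) :
    T.Extends (T.connect P free r x) := by
  unfold Tree.connect
  generalize ⌈dist (argMin T.verts (fun v => dist v x)) x / P.η⌉₊ = n
  induction n with
  | zero => exact h.refl
  | succ n ih =>
    rw [Function.iterate_succ_apply']
    exact ih.trans (ih.rooted.extend P free r x).1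

/-- If `q` is within one step of the tree, in a convex free neighbourhood, then the connection step
succeeds: the number of extensions is one, or zero if `q` is a vertex already. -/
theorem Tree.Rooted.mem_connect {T : Tree d} (h : T.Rooted) {v q c : Conf d} {ρ : ℝ}
    (hpos : 0 < P.η) (hv : v ∈ T.verts) (hη : dist v q ≤ P.η) (hq : dist v q + dist q c < ρ)
    (hfree : Metric.ball c ρ ⊆ free) : q ∈ (T.connect P free r q).verts := by
  by_cases hqT : q ∈ T.verts
  · exact (h.connect P free r q).subset hqT
  · have hle : dist (argMin T.verts fun v => dist v q) q ≤ dist v q :=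
      argMin_le (fun v => dist v q) hv
    have hpos' : 0 < dist (argMin T.verts fun v => dist v q) q :=
      dist_pos.2 fun heq => hqT (heq ▸ h.nearest_mem q)
    have hone : ⌈dist (argMin T.verts fun v => dist v q) q / P.η⌉₊ = 1 := by
      rw [Nat.ceil_eq_iff one_ne_zero]
      constructor
      · simpa using div_pos hpos' hpos
      · simpa using (div_le_one hpos).2 (hle.trans hη)
    rw [Tree.connect, hone, Function.iterate_one]
    exact (h.extend P free r q).2 q (Tree.extend_snd_eq_some P free r hv hη hq hfree)

theorem Tree.Rooted.absorb {T : Tree d} (h : T.Rooted) (G : Graph d) {v : Conf d}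
    (hv : v ∈ T.verts) : T.Extends (T.absorb P free r G v) := by
  unfold Tree.absorb
  generalize (G.verts.filter fun u => dist u v ≤ r).toList = l
  induction l generalizing T with
  | nil => exact h.refl
  | cons u l ih =>
    rw [List.foldl_cons]
    split_ifs with hseg
    · have h1 := (h.insert P free r hv hseg).1
      exact h1.trans (ih h1.rooted (h1.subset hv))
    · exact ih h hv

end Operations

/-! ### The planner -/

/-- Both trees of `s'` extend those of `s`. -/
def PlanState.Extends (s s' : PlanState d) : Prop :=
  ∀ b, (s.tree b).Extends (s'.tree b)

/-- Both trees are rooted. -/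
def PlanState.Rooted (s : PlanState d) : Prop :=
  ∀ b, (s.tree b).Rooted

theorem PlanState.Extends.trans {s s' s'' : PlanState d} (h : s.Extends s')
    (h' : s'.Extends s'') : s.Extends s'' :=
  fun b => (h b).trans (h' b)

theorem PlanState.Extends.rooted {s s' : PlanState d} (h : s.Extends s') : s'.Rooted :=
  fun b => (h b).rooted

theorem PlanState.joinTrees_tree (P : Params d) (s : PlanState d) :
    (s.joinTrees P).tree = s.tree := by
  unfold PlanState.joinTrees
  extract_lets
  split_ifs <;> rfl

theorem PlanState.useGraph_tree (P : Params d) (free : Set (Conf d)) (G : Graph d)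
    (s : PlanState d) : (s.useGraph P free G).tree = s.tree := by
  unfold PlanState.useGraph
  split_ifs <;> rfl

section Grow

variable (P : Params d) (free : Set (Conf d)) (G : Graph d)

theorem PlanState.grow_of_none {b : Bool} {q : Conf d} {s : PlanState d}
    (h : ((s.tree b).extend P free (P.eps (s.tree b).verts.card) q).2 = none) :
    s.grow P free G b q = s := by
  unfold PlanState.grow
  extract_lets r
  split
  · rfl
  · rename_i heq
    rw [heq] at h
    cases h

/-- The trees after a successful extension to `v`. -/
theorem PlanState.grow_of_some {b : Bool} {q v : Conf d} {s : PlanState d}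
    (h : ((s.tree b).extend P free (P.eps (s.tree b).verts.card) q).2 = some v) :
    (s.grow P free G b q).tree b =
        ((s.tree b).extend P free (P.eps (s.tree b).verts.card) q).1.absorb P free
          (P.eps (s.tree b).verts.card) G v ∧
      (s.grow P free G b q).tree (!b) =
        (s.tree (!b)).connect P free (P.eps (s.tree b).verts.card) v := by
  unfold PlanState.grow
  extract_lets r
  split
  · rename_i heq
    rw [heq] at h
    cases h
  · rename_i T w heq
    rw [heq] at h
    obtain rfl : w = v := by simpa using h
    rw [heq, PlanState.useGraph_tree]
    simp only [PlanState.joinTrees_tree]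
    cases b <;> simp [r]

theorem PlanState.Rooted.grow {s : PlanState d} (hs : s.Rooted) (b : Bool) (q : Conf d) :
    s.Extends (s.grow P free G b q) := by
  rcases h : ((s.tree b).extend P free (P.eps (s.tree b).verts.card) q).2 with _ | v
  · rw [PlanState.grow_of_none P free G h]
    exact fun b => (hs b).refl
  · obtain ⟨h1, h2⟩ := PlanState.grow_of_some P free G h
    obtain ⟨hext, hmem⟩ := (hs b).extend P free (P.eps (s.tree b).verts.card) q
    have hb : (s.tree b).Extends ((s.grow P free G b q).tree b) := by
      rw [h1]
      exact hext.trans (hext.rooted.absorb P free _ G (hmem v h))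
    have hb' : (s.tree !b).Extends ((s.grow P free G b q).tree !b) := by
      rw [h2]
      exact (hs !b).connect P free _ v
    intro b'
    rcases Bool.eq_or_eq_not b' b with rfl | rfl
    exacts [hb, hb']

/-- If a vertex `v` of the tree is close to the sample `q`, in a convex free neighbourhood, then `q`
itself becomes a vertex. -/
theorem PlanState.Rooted.mem_grow {s : PlanState d} (hs : s.Rooted) {b : Bool} {v q c : Conf d}
    {ρ : ℝ} (hv : v ∈ (s.tree b).verts) (hη : dist v q ≤ P.η) (hq : dist v q + dist q c < ρ)
    (hfree : Metric.ball c ρ ⊆ free) : q ∈ ((s.grow P free G b q).tree b).verts := by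
  have h := Tree.extend_snd_eq_some P free (P.eps (s.tree b).verts.card) hv hη hq hfree
  obtain ⟨hext, hmem⟩ := (hs b).extend P free (P.eps (s.tree b).verts.card) q
  rw [(PlanState.grow_of_some P free G h).1]
  exact (hext.rooted.absorb P free _ G (hmem q h)).subset (hmem q h)

/-- If moreover the other tree has a vertex close to `q`, it is connected to `q`. -/
theorem PlanState.Rooted.mem_grow_not {s : PlanState d} (hs : s.Rooted) {b : Bool}
    {v w q c : Conf d} {ρ : ℝ} (hpos : 0 < P.η) (hv : v ∈ (s.tree b).verts)
    (hη : dist v q ≤ P.η) (hq : dist v q + dist q c < ρ) (hw : w ∈ (s.tree !b).verts)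
    (hη' : dist w q ≤ P.η) (hq' : dist w q + dist q c < ρ) (hfree : Metric.ball c ρ ⊆ free) :
    q ∈ ((s.grow P free G b q).tree !b).verts := by
  have h := Tree.extend_snd_eq_some P free (P.eps (s.tree b).verts.card) hv hη hq hfree
  rw [(PlanState.grow_of_some P free G h).2]
  exact (hs !b).mem_connect P free _ hpos hw hη' hq' hfree

end Grow

section Plan

variable (P : Params d) (Q : Query d) (G : Graph d) (z : ℕ → Bool → Conf d)

theorem plan_rooted (t : ℕ) : (plan P Q G z t).Rooted := by
  induction t with
  | zero => exact fun b => Tree.single_rooted _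
  | succ t ih =>
    have h := ih.grow P Q.free G false (z t false)
    exact (h.rooted.grow P Q.free G true (z t true)).rooted

theorem plan_extends_succ (t : ℕ) : (plan P Q G z t).Extends (plan P Q G z (t + 1)) := by
  have h := (plan_rooted P Q G z t).grow P Q.free G false (z t false)
  exact h.trans (h.rooted.grow P Q.free G true (z t true))

theorem plan_extends {t t' : ℕ} (h : t ≤ t') : (plan P Q G z t).Extends (plan P Q G z t') := by
  induction t', h using Nat.le_induction with
  | base => exact fun b => (plan_rooted P Q G z t b).refl
  | succ n _ ih => exact ih.trans (plan_extends_succ P Q G z n)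

theorem plan_root (t : ℕ) (b : Bool) :
    ((plan P Q G z t).tree b).root = if b then Q.target else Q.init :=
  (plan_extends P Q G z (Nat.zero_le t) b).root_eq

/-- The verified edges of a tree join each vertex to the root. -/
theorem PlanState.Rooted.joined_root {s : PlanState d} (hs : s.Rooted) {b : Bool} {v : Conf d}
    (hv : v ∈ (s.tree b).verts) :
    Relation.ReflTransGen (fun u v => s.Joined u v ∨ s.Joined v u) v (s.tree b).root := by
  obtain ⟨k, hk⟩ := (hs b).reach v hv
  induction k generalizing v with
  | zero => exact hk ▸ .refl
  | succ k ih =>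
    exact .head (Or.inl (Or.inl ⟨b, hv, rfl⟩)) (ih ((hs b).parent_mem v hv) hk)

/-- Once the two trees share a vertex, the target is reachable. -/
theorem target_mem_reachable {t : ℕ} {v : Conf d}
    (hv : ∀ b, v ∈ ((plan P Q G z t).tree b).verts) :
    Q.target ∈ (plan P Q G z t).reachable := by
  have hroot := (plan_rooted P Q G z t).joined_root (hv false)
  have htarget := (plan_rooted P Q G z t).joined_root (hv true)
  rw [plan_root, if_pos rfl] at htarget
  have : Std.Symm fun u v => (plan P Q G z t).Joined u v ∨ (plan P Q G z t).Joined v u :=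
    ⟨fun _ _ h => h.symm⟩
  exact (Std.Symm.symm _ _ hroot).trans htarget

/-- A chain `x 0, …, x N` of centres of free balls from the initial to the target configuration. If
in each of the `N` successive blocks of `m` rounds, the first tree gets a sample near the next
centre, then the two trees meet. -/
theorem target_mem_reachable_of_samples {x : ℕ → Conf d} {N m t : ℕ} {δ : ℝ} (hN : 0 < N)
    (hδ : 0 < δ) (hη : 3 * δ ≤ P.η) (h0 : x 0 = Q.init) (hlast : x N = Q.target)
    (hfree : ∀ i ≤ N, Metric.ball (x i) (4 * δ) ⊆ Q.free)
    (hdist : ∀ i < N, dist (x i) (x (i + 1)) < δ)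
    (hz : ∀ i < N, ∃ j < m, z (i * m + j) false ∈ Metric.ball (x (i + 1)) δ) (ht : N * m ≤ t) :
    Q.target ∈ (plan P Q G z t).reachable := by
  have hstep : ∀ {i : ℕ} {v q : Conf d}, i < N → v ∈ Metric.ball (x i) δ →
      q ∈ Metric.ball (x (i + 1)) δ →
      dist v q ≤ P.η ∧ dist v q + dist q (x (i + 1)) < 4 * δ := by
    intro i v q hi hv hq
    have h1 := dist_triangle4 v (x i) (x (i + 1)) q
    have h2 := hdist i hi
    rw [Metric.mem_ball] at hv hq
    rw [dist_comm (x (i + 1)) q] at h1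
    constructor <;> linarith
  have hvertex : ∀ i ≤ N, ∃ v ∈ ((plan P Q G z (i * m)).tree false).verts,
      v ∈ Metric.ball (x i) δ := by
    intro i hi
    induction i with
    | zero =>
      refine ⟨x 0, ?_, Metric.mem_ball_self hδ⟩
      rw [zero_mul, h0]
      exact Finset.mem_singleton_self _
    | succ i ih =>
      obtain ⟨v, hv, hvx⟩ := ih (by omega)
      obtain ⟨j, hj, hq⟩ := hz i hi
      have hv' := (plan_extends P Q G z (Nat.le_add_right (i * m) j) false).subset hv
      obtain ⟨h1, h2⟩ := hstep hi hvx hq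
      have hmem := (plan_rooted P Q G z (i * m + j)).mem_grow P Q.free G hv' h1 h2
        (hfree (i + 1) hi)
      have hg := (plan_rooted P Q G z (i * m + j)).grow P Q.free G false (z (i * m + j) false)
      have hmem' := (hg.rooted.grow P Q.free G true (z (i * m + j) true) false).subset hmem
      refine ⟨_, (plan_extends P Q G z (t := i * m + j + 1) ?_ false).subset hmem', hq⟩
      rw [Nat.succ_mul]
      omega
  obtain ⟨n, rfl⟩ : ∃ n, N = n + 1 := ⟨N - 1, by omega⟩
  obtain ⟨v, hv, hvx⟩ := hvertex n (by omega)
  obtain ⟨j, hj, hq⟩ := hz n (by omega)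
  obtain ⟨h1, h2⟩ := hstep (Nat.lt_succ_self n) hvx hq
  have hs := plan_rooted P Q G z (n * m + j)
  have hv' := (plan_extends P Q G z (Nat.le_add_right (n * m) j) false).subset hv
  have hw : Q.target ∈ ((plan P Q G z (n * m + j)).tree true).verts := by
    have := (hs true).root_mem
    rwa [plan_root, if_pos rfl] at this
  have hq' := Metric.mem_ball.1 hq
  rw [hlast, dist_comm] at hq'
  have hb := hfree (n + 1) le_rfl
  have hmem0 := hs.mem_grow P Q.free G hv' h1 h2 hb
  have hmem1 := hs.mem_grow_not P Q.free G (b := false) (by linarith) hv' h1 h2 hw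
    (by linarith) (by rw [hlast, dist_comm _ Q.target]; linarith) hb
  have hg := hs.grow P Q.free G false (z (n * m + j) false)
  have hg' := hg.rooted.grow P Q.free G true (z (n * m + j) true)
  have hle : n * m + j + 1 ≤ t := by
    rw [Nat.succ_mul] at ht
    omega
  refine target_mem_reachable P Q G z (v := z (n * m + j) false) fun b => ?_
  refine (plan_extends P Q G z hle b).subset ((hg' b).subset ?_)
  cases b
  exacts [hmem0, hmem1]

end Plan

/-! ### Chains of free balls along a solution -/

/-- A solution path is followed by a finite chain of points, at small distances from each other and
with a common clearance. -/
theorem Query.Solvable.exists_chain {Q : Query d} (h : Q.Solvable) {η : ℝ} (hη : 0 < η) :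
    ∃ (x : ℕ → Conf d) (N : ℕ) (δ : ℝ), 0 < N ∧ 0 < δ ∧ 3 * δ ≤ η ∧ x 0 = Q.init ∧
      x N = Q.target ∧ (∀ i ≤ N, Metric.ball (x i) (4 * δ) ⊆ Q.free) ∧
      ∀ i < N, dist (x i) (x (i + 1)) < δ := by
  obtain ⟨σ, hσ, h0, h1, hint⟩ := h
  obtain ⟨ε, hε, hsub⟩ := (isCompact_Icc.image_of_continuousOn hσ).exists_thickening_subset_open
    isOpen_interior (Set.image_subset_iff.2 hint)
  set δ := min (ε / 4) (η / 3) with hδdef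
  have hδ : 0 < δ := lt_min (by linarith) (by linarith)
  have hδε : 4 * δ ≤ ε := by linarith [min_le_left (ε / 4) (η / 3)]
  have huc := isCompact_Icc.uniformContinuousOn_of_continuous hσ
  obtain ⟨κ, hκ, huc⟩ := Metric.uniformContinuousOn_iff.1 huc δ hδ
  obtain ⟨n, hn⟩ := exists_nat_one_div_lt hκ
  have hn0 : (0 : ℝ) < n + 1 := by positivity
  have hIcc : ∀ i ≤ n + 1, (i : ℝ) / (n + 1) ∈ Set.Icc (0 : ℝ) 1 := by
    intro i hi
    refine ⟨by positivity, (div_le_one hn0).2 (by exact_mod_cast hi)⟩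
  refine ⟨fun i => σ (i / (n + 1)), n + 1, δ, n.succ_pos, hδ, ?_, by simpa using h0, ?_, ?_, ?_⟩
  · linarith [min_le_right (ε / 4) (η / 3)]
  · push_cast
    rw [div_self hn0.ne', h1]
  · intro i hi
    refine (Metric.ball_subset_ball hδε).trans (Set.Subset.trans ?_ interior_subset)
    exact (Metric.ball_subset_thickening (Set.mem_image_of_mem σ (hIcc i hi)) ε).trans hsub
  · intro i hi
    refine huc _ (hIcc i hi.le) _ (hIcc (i + 1) hi) ?_
    rw [dist_comm, Real.dist_eq, ← sub_div, Nat.cast_add_one, add_sub_cancel_left,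
      abs_of_pos (by positivity)]
    exact hn

/-! ### Sampling -/

/-- A ball in a sampling region of finite volume is missed with probability less than one. -/
theorem cond_volume_ball_compl_lt_one {S : Set (Conf d)} (hS : MeasurableSet S)
    (hfin : volume S ≠ ∞) {c : Conf d} {δ : ℝ} (hδ : 0 < δ) (hsub : Metric.ball c δ ⊆ S) :
    cond volume S (Metric.ball c δ)ᶜ < 1 := by
  have hball : 0 < volume (Metric.ball c δ) := Metric.measure_ball_pos volume c hδ
  have : IsProbabilityMeasure (cond (volume : Measure (Conf d)) S) :=
    cond_isProbabilityMeasure_of_finite (hball.trans_le (measure_mono hsub)).ne' hfin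
  rw [prob_compl_eq_one_sub measurableSet_ball]
  refine ENNReal.sub_lt_self ENNReal.one_ne_top one_ne_zero ?_
  rw [cond_apply hS, Set.inter_eq_self_of_subset_right hsub]
  exact mul_ne_zero (ENNReal.inv_ne_zero.2 hfin) hball.ne'

/-- Independent samples with law `ν` all miss `B` with probability `ν Bᶜ` to the power of their
number. -/
theorem measure_forall_not_mem {ι Ω E : Type*} [MeasurableSpace Ω] [MeasurableSpace E]
    {μ : Measure Ω} {z : ι → Ω → E} (hz : iIndepFun z μ) {ν : Measure E} {B : Set E}
    (hB : MeasurableSet B) (S : Finset ι) (hlaw : ∀ i ∈ S, HasLaw (z i) ν μ) :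
    μ {ω | ∀ i ∈ S, z i ω ∉ B} = ν Bᶜ ^ S.card := by
  have hset : {ω | ∀ i ∈ S, z i ω ∉ B} = ⋂ i ∈ S, z i ⁻¹' Bᶜ := by
    ext ω
    simp
  rw [hset, hz.measure_inter_preimage_eq_mul S fun i _ => hB.compl, ← Finset.prod_const]
  refine Finset.prod_congr rfl fun i hi => ?_
  rw [← (hlaw i hi).map_eq, Measure.map_apply_of_aemeasurable (hlaw i hi).aemeasurable hB.compl]

end LTR

/-! ### Probabilistic completeness -/

/-- Request `k` of the list is the reaching part (`k = 2 i`) or the carrying part (`k = 2 i + 1`) of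
task number `i`. The rounds `budget t j` granted to the earlier requests `j < k` may depend on `t` in
any way (for example: all equal to `t`, or all fixed). As no measurability of the event is claimed,
the conclusion is stated for the event and for its complement. -/
theorem theorem2 {d : ℕ} (hd : 0 < d) {Obj : Type*}
    (free region : LTR.World Obj → Set (LTR.Conf d))
    (fq : Obj → LTR.Pose → LTR.Conf d)
    (w₀ : LTR.World Obj) (q₀ : LTR.Conf d) (tasks : List (LTR.Task Obj))
    (Qs : List (LTR.Query d)) (hQs : Qs = LTR.queries free region fq w₀ q₀ tasks)
    (hfree : ∀ Q ∈ Qs, MeasurableSet Q.free)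
    (hregion : ∀ Q ∈ Qs, MeasurableSet Q.region ∧ volume Q.region ≠ ∞ ∧ Q.free ⊆ Q.region)
    (P : LTR.Params d) (hη : 0 < P.η) (hγ : ∀ Q ∈ Qs, LTR.gammaStar Q.free < P.γ)
    {Ω : Type*} [MeasurableSpace Ω] (μ : Measure Ω) [IsProbabilityMeasure μ]
    (z : ℕ × ℕ × Bool → Ω → LTR.Conf d)
    (hz_indep : iIndepFun z μ)
    (hz_law : ∀ (k : ℕ) (hk : k < Qs.length) (t : ℕ) (b : Bool),
      HasLaw (z (k, t, b)) (cond volume Qs[k].region) μ)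
    (hsol : ∀ Q ∈ Qs, Q.Solvable)
    (budget : ℕ → ℕ → ℕ) (k : ℕ) (hk : k < Qs.length) :
    Tendsto (fun t => μ {ω | (LTR.reachableSet P Qs (budget t) (fun j s b => z (j, s, b) ω) k hk t ∩
        {Qs[k].target}).Nonempty}) atTop (𝓝 1) ∧
      Tendsto (fun t => μ {ω | ¬ (LTR.reachableSet P Qs (budget t) (fun j s b => z (j, s, b) ω) k hk t ∩
        {Qs[k].target}).Nonempty}) atTop (𝓝 0) := by
  obtain ⟨x, N, δ, hN, hδ, hδη, h0, hlast, hball, hdist⟩ :=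
    (hsol _ (List.getElem_mem hk)).exists_chain hη
  obtain ⟨hreg, hfin, hsub⟩ := hregion _ (List.getElem_mem hk)
  set ν : Measure (LTR.Conf d) := cond volume Qs[k].region
  -- With blocks of `t / N` rounds, failure means that some block misses its ball.
  have hbound : ∀ t, μ {ω | ¬ (LTR.reachableSet P Qs (budget t) (fun j s b => z (j, s, b) ω) k hk t ∩
      {Qs[k].target}).Nonempty} ≤
      ∑ i ∈ Finset.range N, ν (Metric.ball (x (i + 1)) δ)ᶜ ^ (t / N) := by
    intro t
    have hblock : ∀ i, μ {ω | ∀ a ∈ (Finset.range (t / N)).image fun j => (k, i * (t / N) + j, false),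
        z a ω ∉ Metric.ball (x (i + 1)) δ} = ν (Metric.ball (x (i + 1)) δ)ᶜ ^ (t / N) := by
      intro i
      rw [LTR.measure_forall_not_mem hz_indep (ν := ν) measurableSet_ball,
        Finset.card_image_of_injective _ fun a b hab => by simpa using hab, Finset.card_range]
      intro a ha
      obtain ⟨j, -, rfl⟩ := Finset.mem_image.1 ha
      exact hz_law k hk _ false
    simp_rw [← hblock]
    refine (measure_mono fun ω hω => ?_).trans (measure_biUnion_finset_le _ _)
    by_contra hcon
    refine hω ⟨_, ?_, rfl⟩
    refine LTR.target_mem_reachable_of_samples P _ _ _ hN hδ hδη h0 hlast hball hdist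
      (m := t / N) (fun i hi => ?_) (Nat.mul_div_le t N)
    simpa [hi] using fun h => hcon (Set.mem_iUnion₂.2 ⟨i, Finset.mem_range.2 hi, h⟩)
  have hlim : Tendsto (fun t => ∑ i ∈ Finset.range N, ν (Metric.ball (x (i + 1)) δ)ᶜ ^ (t / N))
      atTop (𝓝 0) := by
    rw [← Finset.sum_const_zero (s := Finset.range N)]
    refine tendsto_finsetSum _ fun i hi => ?_
    have hlt : ν (Metric.ball (x (i + 1)) δ)ᶜ < 1 :=
      LTR.cond_volume_ball_compl_lt_one hreg hfin hδ
        (((Metric.ball_subset_ball (by linarith)).trans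
          (hball (i + 1) (Finset.mem_range.1 hi))).trans hsub)
    exact (ENNReal.tendsto_pow_atTop_nhds_zero_of_lt_one hlt).comp
      (Nat.tendsto_div_const_atTop hN.ne')
  have hfail := tendsto_of_tendsto_of_tendsto_of_le_of_le tendsto_const_nhds hlim
    (fun _ => zero_le) hbound
  refine ⟨?_, hfail⟩
  have hsub1 := ENNReal.Tendsto.sub (tendsto_const_nhds (x := (1 : ℝ≥0∞))) hfail
    (Or.inl ENNReal.one_ne_top)
  rw [tsub_zero] at hsub1
  refine tendsto_of_tendsto_of_tendsto_of_le_of_le hsub1 tendsto_const_nhds (fun t => ?_)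
    fun t => prob_le_one
  -- Subadditivity replaces additivity, which fails for an event that is not measurable.
  rw [tsub_le_iff_right, ← measure_univ (μ := μ)]
  refine (measure_mono fun ω _ => ?_).trans (measure_union_le _ _)
  exact em _
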